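/- Let $(X,<)$ be a finite nonempty partially ordered set and let $(\beta_x)_{x\in X}$ be mutually independent Bernoulli ($\{0,1\}$-valued) random variables. For $S\subset X$ write $Pr(S)$ for the probability that $\beta_x=1$ for all $x\in S$, and assume $Pr(x):=Pr(\{x\})>0$ for every $x\in X$. In the chained search-and-rescue (CSR) game on $X$, Hider chooses a location $h\in X$ and Searcher chooses a chain $\sigma$, that is, a strictly increasing sequence $\sigma(1)<\sigma(2)<\cdots<\sigma(n)$ of elements of $X$. Searcher's payoff is $Pr(\{\sigma(1),\dots,\sigma(k)\})$ if $h=\sigma(k)$, and $0$ if $h$ does not occur in $\sigma$. Hider's payoff is one minus Searcher's payoff, and both players may use mixed strategies. For $x\in X$ let $o_x=\frac{1-Pr(x)}{Pr(x)}$ be the odds of failure, and for $S\subset X$ put $O_S=\sum_{x\in S}o_x$. An antichain $A\subset X$ is called maximal if for every $x\in X$ there is an $a\in A$ such that $a\le x$ or $x\le a$; put $A^-=\{x\in X: x\le a \text{ for some } a\in A\}$. Then there is a maximal antichain that maximizes $O_{A^-}+|A|$ among all maximal antichains $A$ of $X$, and for every such maximizing $A$ the value of the CSR game on $X$ is equal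 to \[ \frac{1}{O_{A^-}+|A|}. \] -/

import Mathlib

open MeasureTheory ProbabilityTheory

noncomputable section

/-- `b` is a Bernoulli random variable: it is measurable and takes only the values 0 and 1. -/
def IsBernoulliVariable {Ω : Type*} [MeasurableSpace Ω] (μ : Measure Ω) (b : Ω → ℝ) : Prop :=
  Measurable b ∧ ∀ᵐ ω ∂μ, b ω = 0 ∨ b ω = 1

/-- `Pr(S)`, the probability that `β x = 1` for all `x ∈ S`. -/
def successProb {Ω X : Type*} [MeasurableSpace Ω] (μ : Measure Ω) (β : X → Ω → ℝ)
    (S : Set X) : ℝ :=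
  μ.real {ω | ∀ x ∈ S, β x ω = 1}

/-- The odds of failure `o_x = (1 - Pr(x)) / Pr(x)`. -/
def failureOdds {Ω X : Type*} [MeasurableSpace Ω] (μ : Measure Ω) (β : X → Ω → ℝ) (x : X) : ℝ :=
  (1 - successProb μ β {x}) / successProb μ β {x}

open Classical in
/-- `O_S`, the sum of the odds of failure over `S`. -/
def oddsSum {Ω X : Type*} [MeasurableSpace Ω] [Fintype X] (μ : Measure Ω) (β : X → Ω → ℝ)
    (S : Set X) : ℝ :=
  ∑ x ∈ Finset.univ.filter (fun x => x ∈ S), failureOdds μ β x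

/-- A search by chains: a strictly increasing finite sequence of locations
(possibly the empty one). -/
structure ChainSearch (X : Type*) [PartialOrder X] where
  /-- the number of locations on the search -/
  length : ℕ
  /-- the location that is searched at each step -/
  loc : Fin length → X
  /-- each location is above all the earlier ones -/
  strictMono : StrictMono loc

/-- Since a chain search visits every location at most once, there are finitely many of them. -/
instance ChainSearch.instFinite {X : Type*} [PartialOrder X] [Finite X] :
    Finite (ChainSearch X) := by
  have := Fintype.ofFinite X
  let e : ChainSearch X → (n : Fin (Fintype.card X + 1)) × (Fin n → X) := fun σ =>
    ⟨⟨σ.length, Nat.lt_succ_of_le (by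
      simpa using Fintype.card_le_of_injective σ.loc σ.strictMono.injective)⟩, σ.loc⟩
  refine Finite.of_injective e ?_
  rintro ⟨n, f, hf⟩ ⟨m, g, hg⟩ h
  simp only [e, Sigma.mk.injEq, Fin.mk.injEq] at h
  obtain ⟨h1, h2⟩ := h
  subst h1
  simp only [heq_eq_eq] at h2
  subst h2
  rfl

instance ChainSearch.instFintype {X : Type*} [PartialOrder X] [Finite X] :
    Fintype (ChainSearch X) :=
  Fintype.ofFinite _

/-- The locations that the search `σ` has searched by the moment it searches `h`
(`h` included). -/
def ChainSearch.searchedUpTo {X : Type*} [PartialOrder X] (σ : ChainSearch X) (h : X) : Set X :=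
  {x | ∃ k : Fin σ.length, σ.loc k = h ∧ ∃ i ≤ k, σ.loc i = x}

open Classical in
/-- The payoff to the Searcher in the chained search-and-rescue game: the probability that all
locations searched up to and including the hiding place `h` are searched successfully, and zero
if `σ` never searches `h`. -/
def csrPayoff {Ω X : Type*} [MeasurableSpace Ω] [PartialOrder X] (μ : Measure Ω)
    (β : X → Ω → ℝ) (σ : ChainSearch X) (h : X) : ℝ :=
  if h ∈ Set.range σ.loc then successProb μ β (σ.searchedUpTo h) else 0

/-- The expected payoff of a pair of mixed strategies in a finite game. -/
def expectedPayoff {S H : Type*} [Fintype S] [Fintype H] (P : S → H → ℝ)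
    (p : S → ℝ) (q : H → ℝ) : ℝ :=
  ∑ s, ∑ h, p s * q h * P s h

/-- `v` is the value of the finite two-person constant-sum game with payoff `P` to the maximizing
player I: it is the largest expected payoff that player I can guarantee by a mixed strategy, and
the smallest one to which player II can restrict her by a mixed strategy. -/
def IsGameValue {S H : Type*} [Fintype S] [Fintype H] (P : S → H → ℝ) (v : ℝ) : Prop :=
  IsGreatest {w | ∃ p ∈ stdSimplex ℝ S, ∀ q ∈ stdSimplex ℝ H, w ≤ expectedPayoff P p q} v ∧
  IsLeast {w | ∃ q ∈ stdSimplex ℝ H, ∀ p ∈ stdSimplex ℝ S, expectedPayoff P p q ≤ w} v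

/-- A maximal antichain: an antichain such that every element is comparable to one of its
elements. -/
def IsMaximalAntichain {X : Type*} [PartialOrder X] (A : Set X) : Prop :=
  IsAntichain (· ≤ ·) A ∧ ∀ x, ∃ a ∈ A, a ≤ x ∨ x ≤ a

/-- `A⁻`, the set of elements that lie at or below `A`. -/
def belowSet {X : Type*} [PartialOrder X] (A : Set X) : Set X :=
  {x | ∃ a ∈ A, x ≤ a}

/-- The quantity `O_{A⁻} + |A|`. -/
def antichainWeight {Ω X : Type*} [MeasurableSpace Ω] [Fintype X] [PartialOrder X]
    (μ : Measure Ω) (β : X → Ω → ℝ) (A : Set X) : ℝ :=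
  oddsSum μ β (belowSet A) + (A.ncard : ℝ)

/-- `A` is a maximal antichain, and maximizes `O_{A⁻} + |A|` among the maximal antichains. -/
def IsOptimalAntichain {Ω X : Type*} [MeasurableSpace Ω] [Fintype X] [PartialOrder X]
    (μ : Measure Ω) (β : X → Ω → ℝ) (A : Set X) : Prop :=
  IsMaximalAntichain A ∧
    ∀ B : Set X, IsMaximalAntichain B → antichainWeight μ β B ≤ antichainWeight μ β A

end

/-! Let `M` be the optimal antichain weight. Hider gives `x` weight `o_x` if `x ∈ A⁻`, plus 1 if `x
∈ A`, divided by the total `M`. A chain scores at most 1 against the undivided weights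
(`chainScore_hiderWeight_le_one`), so Searcher gets at most `1 / M`.

For Searcher, `exists_mixed_of_forall_exists_pure` reduces the claim to finding, for each Hider
mixture `q`, one chain scoring at least `1 / M`. Let `U x` and `m x` be the best scores of chains in
`Ici x` and `Ioi x`. Prepending `x` gives `p x * (q x + m x) ≤ U x`, that is, `q x ≤ o_x * U x + (U
x - m x)`. Sum over `x` and write the right side as an integral over levels `θ`. The set `{m < θ ≤
U}` is an antichain and `{θ ≤ U}` lies below it, so each level contributes at most `M`. Hence `1 = ∑
q ≤ W * M`, where `W` is the best score of all chains (`sum_le_bestScore_mul`). -/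

/-! ### Minimax by separation of convex sets. -/

section Minimax

open Finset in
/-- The hard half of the minimax theorem for finite games. -/
theorem exists_mixed_of_forall_exists_pure {S H : Type*} [Fintype S] [Fintype H] [Nonempty S]
    (P : S → H → ℝ) (v : ℝ)
    (hv : ∀ q ∈ stdSimplex ℝ H, ∃ s, v ≤ ∑ h, q h * P s h) :
    ∃ p ∈ stdSimplex ℝ S, ∀ h, v ≤ ∑ s, p s * P s h := by
  classical
  by_contra! hcon
  let L : (S → ℝ) →ₗ[ℝ] (H → ℝ) :=
    { toFun := fun p h => ∑ s, p s * P s h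
      map_add' := by
        intro a b; ext h; simp [add_mul, sum_add_distrib]
      map_smul' := by
        intro c a; ext h; simp [mul_sum, mul_assoc] }
  have hLc : Continuous L := L.continuous_of_finiteDimensional
  -- If the conclusion fails, no attainable payoff vector lies in the orthant above the constant
  -- `v`.
  have hdisj : Disjoint (L '' stdSimplex ℝ S) (Set.Ici (fun _ : H => v)) := by
    rw [Set.disjoint_left]
    rintro _ ⟨p, hp, rfl⟩ hmem
    obtain ⟨h, hh⟩ := hcon p hp
    exact absurd (hmem h) (not_le.mpr hh)
  obtain ⟨f, u, u', hC, huu', hD⟩ := geometric_hahn_banach_compact_closed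
    ((convex_stdSimplex ℝ S).linear_image L) ((isCompact_stdSimplex ℝ S).image hLc)
    (convex_Ici (𝕜 := ℝ) (fun _ : H => v)) isClosed_Ici hdisj
  set a : H → ℝ := fun h => f (Pi.single h 1) with ha
  have hf : ∀ x : H → ℝ, f x = ∑ h, x h * a h := by
    intro x
    conv_lhs => rw [pi_eq_sum_univ' x]
    simp only [map_sum, map_smul, smul_eq_mul, ha]
  have hapos : ∀ h, 0 ≤ a h := by
    intro h
    by_contra! hneg
    have h1 := hD (fun _ => v) (Set.mem_Ici.mpr le_rfl)
    -- Moving this far along coordinate `h` stays in the orthant but brings `f` down to exactly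
    -- `u'`, against the strict separation.
    have ht : 0 ≤ (f (fun _ => v) - u') / (-a h) := div_nonneg (by linarith) (by linarith)
    have h2 := hD ((fun _ => v) + ((f (fun _ => v) - u') / (-a h)) • Pi.single h 1) (by
      rw [Set.mem_Ici]
      exact le_add_of_nonneg_right (smul_nonneg ht (by simp [Pi.single_nonneg])))
    rw [map_add, map_smul, smul_eq_mul] at h2
    change u' < _ + _ * a h at h2
    have : (f (fun _ => v) - u') / (-a h) * a h = -(f (fun _ => v) - u') := by
      rw [div_neg, neg_mul, div_mul_cancel₀ _ hneg.ne]
    linarith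
  have hpure : ∀ s, ∑ h, P s h * a h < v * ∑ h, a h := by
    intro s
    have h1 := hC (L (Pi.single s 1)) ⟨_, single_mem_stdSimplex ℝ s, rfl⟩
    have h2 := hD (fun _ => v) (Set.mem_Ici.mpr le_rfl)
    rw [hf] at h1 h2
    have h3 : ∀ h, L (Pi.single s 1) h = P s h := by
      intro h
      simp [L, Pi.single_apply]
    simp only [h3] at h1
    rw [← mul_sum] at h2
    linarith
  have hsum : 0 < ∑ h, a h := by
    refine lt_of_le_of_ne (sum_nonneg fun h _ => hapos h) fun h0 => ?_
    have hz := (sum_eq_zero_iff_of_nonneg fun h _ => hapos h).mp h0.symm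
    obtain ⟨s⟩ := ‹Nonempty S›
    have := hpure s
    rw [← h0, sum_eq_zero (fun h hh => by rw [hz h hh, mul_zero])] at this
    simp at this
  -- The normalized separating functional is a mixture of player II holding every pure strategy
  -- below `v`.
  obtain ⟨s, hs⟩ := hv (fun h => a h / ∑ h, a h)
    ⟨fun h => div_nonneg (hapos h) hsum.le, by rw [← sum_div, div_self hsum.ne']⟩
  have h1 : ∑ h, a h / (∑ h, a h) * P s h = (∑ h, P s h * a h) / ∑ h, a h := by
    rw [sum_div]
    exact sum_congr rfl fun h _ => by ring
  rw [h1, le_div_iff₀ hsum] at hs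
  exact absurd (hpure s) (not_lt.mpr hs)

theorem isGameValue_of_strategies {S H : Type*} [Fintype S] [Fintype H] {P : S → H → ℝ} {v : ℝ}
    {p : S → ℝ} {q : H → ℝ} (hp : p ∈ stdSimplex ℝ S) (hq : q ∈ stdSimplex ℝ H)
    (hpv : ∀ h, v ≤ ∑ s, p s * P s h) (hqv : ∀ s, ∑ h, q h * P s h ≤ v) :
    IsGameValue P v := by
  have h1 : ∀ q' ∈ stdSimplex ℝ H, v ≤ expectedPayoff P p q' := by
    intro q' hq'
    unfold expectedPayoff
    rw [Finset.sum_comm]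
    calc v = ∑ h, q' h * v := by rw [← Finset.sum_mul, hq'.2, one_mul]
      _ ≤ ∑ h, q' h * ∑ s, p s * P s h :=
        Finset.sum_le_sum fun h _ => mul_le_mul_of_nonneg_left (hpv h) (hq'.1 h)
      _ = _ := by
        simp only [Finset.mul_sum]
        exact Finset.sum_congr rfl fun h _ => Finset.sum_congr rfl fun s _ => by ring
  have h2 : ∀ p' ∈ stdSimplex ℝ S, expectedPayoff P p' q ≤ v := by
    intro p' hp'
    unfold expectedPayoff
    calc _ = ∑ s, p' s * ∑ h, q h * P s h := by
          simp only [Finset.mul_sum]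
          exact Finset.sum_congr rfl fun h _ => Finset.sum_congr rfl fun s _ => by ring
      _ ≤ ∑ s, p' s * v :=
        Finset.sum_le_sum fun s _ => mul_le_mul_of_nonneg_left (hqv s) (hp'.1 s)
      _ = v := by rw [← Finset.sum_mul, hp'.2, one_mul]
  refine ⟨⟨⟨p, hp, h1⟩, ?_⟩, ⟨⟨q, hq, h2⟩, ?_⟩⟩
  · rintro w ⟨p', hp', hw⟩
    exact (hw q hq).trans (h2 p' hp')
  · rintro w ⟨q', hq', hw⟩
    exact (h1 q' hq').trans (hw p hp)

end Minimax

/-! ### Layer-cake integration. -/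

section Layers

theorem intervalIntegrable_indicator_Ioc (a b c d : ℝ) :
    IntervalIntegrable ((Set.Ioc a b).indicator fun _ => (1 : ℝ)) volume c d :=
  intervalIntegrable_iff.mpr ((integrableOn_const (by simp [Set.uIoc])).indicator measurableSet_Ioc)

theorem integral_indicator_Ioc {a b W : ℝ} (ha : 0 ≤ a) (hab : a ≤ b) (hb : b ≤ W) :
    ∫ θ in (0 : ℝ)..W, (Set.Ioc a b).indicator (fun _ => (1 : ℝ)) θ = b - a := by
  rw [intervalIntegral.integral_of_le (ha.trans (hab.trans hb)),
    setIntegral_indicator measurableSet_Ioc,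
    Set.inter_eq_self_of_subset_right (Set.Ioc_subset_Ioc ha hb)]
  simp [hab]

/-- Integrating a bound on the level sets of `U` and `m` over all levels. -/
theorem sum_le_of_layer_bound {X : Type*} [Fintype X] {o U m : X → ℝ} {W M : ℝ}
    (hW : 0 ≤ W) (hm : ∀ x, 0 ≤ m x) (hmU : ∀ x, m x ≤ U x) (hUW : ∀ x, U x ≤ W)
    (hM : ∀ θ, 0 < θ → ∑ x, (o x * (Set.Ioc 0 (U x)).indicator (fun _ => (1 : ℝ)) θ
      + (Set.Ioc (m x) (U x)).indicator (fun _ => (1 : ℝ)) θ) ≤ M) :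
    ∑ x, (o x * U x + (U x - m x)) ≤ W * M := by
  have hint : ∀ x, IntervalIntegrable (fun θ =>
      o x * (Set.Ioc 0 (U x)).indicator (fun _ => (1 : ℝ)) θ
      + (Set.Ioc (m x) (U x)).indicator (fun _ => (1 : ℝ)) θ) volume 0 W := fun x =>
    ((intervalIntegrable_indicator_Ioc _ _ _ _).const_mul _).add
      (intervalIntegrable_indicator_Ioc _ _ _ _)
  calc ∑ x, (o x * U x + (U x - m x))
      = ∫ θ in (0 : ℝ)..W, ∑ x, (o x * (Set.Ioc 0 (U x)).indicator (fun _ => (1 : ℝ)) θ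
          + (Set.Ioc (m x) (U x)).indicator (fun _ => (1 : ℝ)) θ) := by
        rw [intervalIntegral.integral_finsetSum fun x _ => hint x]
        refine Finset.sum_congr rfl fun x _ => ?_
        rw [intervalIntegral.integral_add
          ((intervalIntegrable_indicator_Ioc _ _ _ _).const_mul _)
          (intervalIntegrable_indicator_Ioc _ _ _ _), intervalIntegral.integral_const_mul,
          integral_indicator_Ioc le_rfl ((hm x).trans (hmU x)) (hUW x),
          integral_indicator_Ioc (hm x) (hmU x) (hUW x), sub_zero]
    _ ≤ ∫ _ in (0 : ℝ)..W, M := by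
        refine intervalIntegral.integral_mono_on_of_le_Ioo hW ?_ (by simp) fun θ hθ => hM θ hθ.1
        simpa only [Finset.sum_fn] using IntervalIntegrable.sum Finset.univ fun x _ => hint x
    _ = W * M := by simp

end Layers

/-! ### Chain scores and Hider's bound. -/

section Score

variable {X : Type*}

/-- The expected payoff of searching `f 0, f 1, …` against weights `q` on the locations, when
location `x` is searched successfully with probability `p x`. -/
def chainScore (p q : X → ℝ) {n : ℕ} (f : Fin n → X) : ℝ :=
  ∑ k, q (f k) * ∏ i, if i ≤ k then p (f i) else 1

/-- Every term contains the factor of the first location, since later finds require that search to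
succeed. -/
theorem chainScore_succ (p q : X → ℝ) {n : ℕ} (f : Fin (n + 1) → X) :
    chainScore p q f = p (f 0) * (q (f 0) + chainScore p q (fun i => f i.succ)) := by
  unfold chainScore
  simp only [Fin.sum_univ_succ, Fin.prod_univ_succ, Fin.zero_le, if_true, Fin.succ_le_succ_iff,
    Fin.le_zero_iff, Fin.succ_ne_zero, if_false, Finset.prod_const_one, mul_one, mul_add,
    Finset.mul_sum]
  congr 1
  · ring
  · exact Finset.sum_congr rfl fun k _ => by ring

theorem chainScore_zero (p q : X → ℝ) (f : Fin 0 → X) : chainScore p q f = 0 := by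
  simp [chainScore]

theorem chainScore_smul (p q : X → ℝ) (c : ℝ) {n : ℕ} (f : Fin n → X) :
    chainScore p (fun x => c * q x) f = c * chainScore p q f := by
  simp [chainScore, Finset.mul_sum, mul_assoc]

open Classical in
/-- The weights of the Hider's strategy that belongs to an antichain. -/
noncomputable def hiderWeight [PartialOrder X] (p : X → ℝ) (A : Set X) (x : X) : ℝ :=
  (if x ∈ belowSet A then (1 - p x) / p x else 0) + (if x ∈ A then 1 else 0)

/-- Induction on the chain. A first location in `A⁻ \ A` gives `(1 - p) + p * rest ≤ 1`; one in `A`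
gives `(1 - p) + p = 1`, as everything later lies outside `A⁻`; one outside `A⁻` adds nothing. -/
theorem chainScore_hiderWeight_le_one [PartialOrder X] {p : X → ℝ} (hp : ∀ x, 0 < p x)
    (hp1 : ∀ x, p x ≤ 1) {A : Set X} (hA : IsAntichain (· ≤ ·) A) {n : ℕ} (f : Fin n → X)
    (hf : StrictMono f) : chainScore p (hiderWeight p A) f ≤ 1 := by
  induction n with
  | zero => simp [chainScore_zero]
  | succ n ih =>
    rw [chainScore_succ]
    have ht := ih (fun i => f i.succ) fun i j hij => hf (Fin.succ_lt_succ_iff.mpr hij)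
    have h0 := hp (f 0)
    by_cases hAx : f 0 ∈ A
    · have hb : f 0 ∈ belowSet A := ⟨_, hAx, le_rfl⟩
      have hz : chainScore p (hiderWeight p A) (fun i => f i.succ) = 0 := by
        refine Finset.sum_eq_zero fun k _ => ?_
        have hlt : f 0 < f k.succ := hf (Fin.succ_pos k)
        have hnb : f k.succ ∉ belowSet A := by
          rintro ⟨a, ha, hle⟩
          exact (hlt.trans_le hle).ne (hA.eq hAx ha (hlt.trans_le hle).le)
        have hna : f k.succ ∉ A := fun h => hnb ⟨_, h, le_rfl⟩
        simp [hiderWeight, hnb, hna]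
      rw [hz]
      simp only [hiderWeight, hAx, hb, if_true]
      apply le_of_eq
      field_simp
      simp
    · by_cases hb : f 0 ∈ belowSet A
      · simp only [hiderWeight, hAx, hb, if_true, if_false] at ht ⊢
        calc _ ≤ p (f 0) * ((1 - p (f 0)) / p (f 0) + 0 + 1) := by gcongr
          _ = 1 := by field_simp; ring
      · have hw : hiderWeight p A (f 0) = 0 := by simp [hiderWeight, hAx, hb]
        rw [hw, zero_add]
        calc _ ≤ p (f 0) * 1 := by gcongr
          _ ≤ 1 := by simpa using hp1 (f 0)

end Score

/-! ### Antichains and their weights. -/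

section Antichains

variable {X : Type*} [PartialOrder X]

theorem IsAntichain.exists_isMaximalAntichain_superset [Finite X] {B : Set X}
    (hB : IsAntichain (· ≤ ·) B) : ∃ A, B ⊆ A ∧ IsMaximalAntichain A := by
  obtain ⟨A, hBA, hA⟩ :=
    (Set.toFinite {A : Set X | IsAntichain (· ≤ ·) A}).exists_le_maximal hB
  refine ⟨A, hBA, hA.prop, fun x => ?_⟩
  by_contra! hx
  have hxA : x ∉ A := fun h => (hx x h).1 le_rfl
  have hins : IsAntichain (· ≤ ·) (insert x A) :=
    IsAntichain.insert hA.prop (fun a ha _ => (hx a ha).1) (fun a ha _ => (hx a ha).2)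
  exact hxA (hA.le_of_ge hins (Set.subset_insert x A) (Set.mem_insert x A))

theorem IsMaximalAntichain.ncard_pos [Finite X] [Nonempty X] {A : Set X}
    (hA : IsMaximalAntichain A) : 0 < A.ncard := by
  obtain ⟨a, ha, -⟩ := hA.2 (Classical.arbitrary X)
  exact (Set.ncard_pos (Set.toFinite A)).mpr ⟨a, ha⟩

open Classical in
theorem sum_hiderWeight [Fintype X] (p : X → ℝ) (A : Set X) :
    ∑ x, hiderWeight p A x =
      ∑ x ∈ Finset.univ.filter (fun x => x ∈ belowSet A), (1 - p x) / p x + (A.ncard : ℝ) := by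
  simp only [hiderWeight, Finset.sum_add_distrib]
  congr 1
  · rw [Finset.sum_filter]
  · rw [Set.ncard_eq_toFinset_card', Finset.sum_boole, Set.filter_mem_univ_eq_toFinset]

/-- Extends the bound `M` from maximal antichains to all antichains, in particular to level sets. -/
theorem sum_hiderWeight_mono [Fintype X] {p : X → ℝ} (hp : ∀ x, 0 < p x) (hp1 : ∀ x, p x ≤ 1)
    {A B : Set X} (h : B ⊆ A) : ∑ x, hiderWeight p B x ≤ ∑ x, hiderWeight p A x := by
  refine Finset.sum_le_sum fun x _ => ?_
  have ho : 0 ≤ (1 - p x) / p x := div_nonneg (by linarith [hp1 x]) (hp x).le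
  unfold hiderWeight
  refine add_le_add ?_ ?_
  · by_cases hx : x ∈ belowSet B
    · obtain ⟨a, ha, hxa⟩ := hx
      rw [if_pos ⟨a, ha, hxa⟩, if_pos ⟨a, h ha, hxa⟩]
    · rw [if_neg hx]; split_ifs <;> simp [ho]
  · by_cases hx : x ∈ B
    · rw [if_pos hx, if_pos (h hx)]
    · rw [if_neg hx]; split_ifs <;> simp

end Antichains

/-! ### Searcher's best replies and their level sets. -/

section BestResponse

variable {X : Type*} [PartialOrder X]

/-- The chain search without locations. -/
def ChainSearch.empty (X : Type*) [PartialOrder X] : ChainSearch X :=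
  ⟨0, Fin.elim0, fun i => i.elim0⟩

/-- Search `x` before everything on `σ`. -/
def ChainSearch.cons (x : X) (σ : ChainSearch X) (h : ∀ k, x < σ.loc k) : ChainSearch X :=
  ⟨σ.length + 1, Fin.cons x σ.loc, by
    intro i j hij
    induction i using Fin.cases with
    | zero =>
      induction j using Fin.cases with
      | zero => exact absurd hij (lt_irrefl _)
      | succ j => simpa using h j
    | succ i =>
      induction j using Fin.cases with
      | zero => exact absurd hij (Fin.not_lt_zero _)
      | succ j => simpa using σ.strictMono (Fin.succ_lt_succ_iff.mp hij)⟩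

/-- The best score of a chain search inside a set of locations. -/
noncomputable def bestScore [Finite X] (p q : X → ℝ) (T : Set X) : ℝ :=
  ⨆ σ : {σ : ChainSearch X // ∀ k, σ.loc k ∈ T}, chainScore p q σ.1.loc

theorem chainScore_le_bestScore [Finite X] (p q : X → ℝ) {T : Set X} (σ : ChainSearch X)
    (hσ : ∀ k, σ.loc k ∈ T) : chainScore p q σ.loc ≤ bestScore p q T :=
  le_ciSup (f := fun σ : {σ : ChainSearch X // ∀ k, σ.loc k ∈ T} => chainScore p q σ.1.loc)
    (Set.finite_range _).bddAbove ⟨σ, hσ⟩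

theorem exists_chainScore_eq_bestScore [Finite X] (p q : X → ℝ) (T : Set X) :
    ∃ σ : ChainSearch X, (∀ k, σ.loc k ∈ T) ∧ chainScore p q σ.loc = bestScore p q T := by
  have : Nonempty {σ : ChainSearch X // ∀ k, σ.loc k ∈ T} :=
    ⟨⟨ChainSearch.empty X, fun k => k.elim0⟩⟩
  obtain ⟨σ, hσ⟩ := exists_eq_ciSup_of_finite
    (f := fun σ : {σ : ChainSearch X // ∀ k, σ.loc k ∈ T} => chainScore p q σ.1.loc)
  exact ⟨σ.1, σ.2, hσ⟩

theorem bestScore_nonneg [Finite X] (p q : X → ℝ) (T : Set X) : 0 ≤ bestScore p q T := by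
  have := chainScore_le_bestScore p q (T := T) (ChainSearch.empty X) fun k => k.elim0
  rwa [ChainSearch.empty, chainScore_zero] at this

theorem bestScore_mono [Finite X] (p q : X → ℝ) {T T' : Set X} (h : T ⊆ T') :
    bestScore p q T ≤ bestScore p q T' := by
  obtain ⟨σ, hσ, he⟩ := exists_chainScore_eq_bestScore p q T
  rw [← he]
  exact chainScore_le_bestScore p q σ fun k => h (hσ k)

theorem mul_add_bestScore_Ioi_le [Finite X] (p q : X → ℝ) (x : X) :
    p x * (q x + bestScore p q (Set.Ioi x)) ≤ bestScore p q (Set.Ici x) := by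
  obtain ⟨σ, hσ, he⟩ := exists_chainScore_eq_bestScore p q (Set.Ioi x)
  have h := chainScore_le_bestScore p q (T := Set.Ici x) (ChainSearch.cons x σ hσ) (by
    intro k
    change (Fin.cons x σ.loc : Fin (σ.length + 1) → X) k ∈ _
    induction k using Fin.cases with
    | zero => simp
    | succ k => simpa using (hσ k).le)
  rw [← he]
  refine le_trans (le_of_eq ?_) h
  change _ = chainScore p q (Fin.cons x σ.loc : Fin (σ.length + 1) → X)
  rw [chainScore_succ]
  simp

theorem exists_bestScore_Ioi_le [Finite X] (p q : X → ℝ) (x : X)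
    (h : 0 < bestScore p q (Set.Ioi x)) :
    ∃ y, x < y ∧ bestScore p q (Set.Ioi x) ≤ bestScore p q (Set.Ici y) := by
  obtain ⟨⟨n, f, hf⟩, hσ, he⟩ := exists_chainScore_eq_bestScore p q (Set.Ioi x)
  cases n with
  | zero => rw [chainScore_zero] at he; exact absurd he h.ne
  | succ n =>
    refine ⟨f 0, hσ (0 : Fin (n + 1)), ?_⟩
    rw [← he]
    exact chainScore_le_bestScore p q ⟨n + 1, f, hf⟩
      fun k => hf.monotone (Fin.zero_le (k : Fin (n + 1)))

/-- The locations at which the best score drops below the level `θ`. -/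
def levelAntichain [Finite X] (p q : X → ℝ) (θ : ℝ) : Set X :=
  {x | bestScore p q (Set.Ioi x) < θ ∧ θ ≤ bestScore p q (Set.Ici x)}

/-- If `x < y` both belonged, `Ici y ⊆ Ioi x` would force `θ ≤ U y ≤ m x < θ`. -/
theorem isAntichain_levelAntichain [Finite X] (p q : X → ℝ) (θ : ℝ) :
    IsAntichain (· ≤ ·) (levelAntichain p q θ) := by
  intro x hx y hy hne hle
  have hlt : x < y := lt_of_le_of_ne hle hne
  have := bestScore_mono p q (T := Set.Ici y) (T' := Set.Ioi x) fun z hz => hlt.trans_le hz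
  exact absurd (hy.2.trans this) (not_le.mpr hx.1)

/-- Take `a ≥ x` maximal with `U a ≥ θ`. If `m a ≥ θ > 0`, an optimal chain above `a` is nonempty
and its first location contradicts maximality. -/
theorem mem_belowSet_levelAntichain [Finite X] (p q : X → ℝ) {θ : ℝ} (hθ : 0 < θ) {x : X}
    (hx : θ ≤ bestScore p q (Set.Ici x)) : x ∈ belowSet (levelAntichain p q θ) := by
  obtain ⟨a, hxa, ha⟩ :=
    (Set.toFinite {y : X | θ ≤ bestScore p q (Set.Ici y)}).exists_le_maximal hx
  refine ⟨a, ⟨?_, ha.prop⟩, hxa⟩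
  by_contra! hle
  obtain ⟨y, hay, hy⟩ := exists_bestScore_Ioi_le p q a (hθ.trans_le hle)
  exact absurd (ha.le_of_ge (hle.trans hy) hay.le) (not_le_of_gt hay)

theorem sum_le_bestScore_mul [Fintype X] {p : X → ℝ} (hp : ∀ x, 0 < p x) (hp1 : ∀ x, p x ≤ 1)
    (q : X → ℝ) {M : ℝ}
    (hM : ∀ A : Set X, IsAntichain (· ≤ ·) A → ∑ x, hiderWeight p A x ≤ M) :
    ∑ x, q x ≤ bestScore p q Set.univ * M := by
  classical
  have ho : ∀ x, 0 ≤ (1 - p x) / p x := fun x =>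
    div_nonneg (by linarith [hp1 x]) (hp x).le
  calc ∑ x, q x
      ≤ ∑ x, ((1 - p x) / p x * bestScore p q (Set.Ici x)
          + (bestScore p q (Set.Ici x) - bestScore p q (Set.Ioi x))) := by
        refine Finset.sum_le_sum fun x _ => ?_
        have h1 := mul_add_bestScore_Ioi_le p q x
        have h2 : (1 - p x) / p x * bestScore p q (Set.Ici x)
          + (bestScore p q (Set.Ici x) - bestScore p q (Set.Ioi x)) =
            bestScore p q (Set.Ici x) / p x - bestScore p q (Set.Ioi x) := by
          have := (hp x).ne'
          field_simp
          ring
        rw [h2, le_sub_iff_add_le, le_div_iff₀ (hp x), mul_comm]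
        exact h1
    _ ≤ _ := by
        refine sum_le_of_layer_bound (bestScore_nonneg p q _) (fun x => bestScore_nonneg p q _)
          (fun x => bestScore_mono p q Set.Ioi_subset_Ici_self)
          (fun x => bestScore_mono p q (Set.subset_univ _)) fun θ hθ => ?_
        refine le_trans (Finset.sum_le_sum fun x _ => ?_)
          (hM _ (isAntichain_levelAntichain p q θ))
        unfold hiderWeight
        refine add_le_add ?_ (le_of_eq ?_)
        · by_cases hx : θ ≤ bestScore p q (Set.Ici x)
          · rw [if_pos (mem_belowSet_levelAntichain p q hθ hx),
              Set.indicator_of_mem (show θ ∈ Set.Ioc 0 _ from ⟨hθ, hx⟩), mul_one]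
          · rw [Set.indicator_of_notMem (fun h => hx h.2), mul_zero]
            split_ifs <;> simp [ho]
        · simp only [Set.indicator_apply, levelAntichain, Set.mem_Ioc, Set.mem_ofPred_eq]
          congr

end BestResponse

/-! ### From the game to chain scores. -/

section Payoff

variable {Ω X : Type*} [MeasurableSpace Ω] {μ : Measure Ω} {β : X → Ω → ℝ}

theorem successProb_coe_finset [IsProbabilityMeasure μ] (hindep : iIndepFun β μ)
    (T : Finset X) : successProb μ β (T : Set X) = ∏ x ∈ T, successProb μ β {x} := by
  have h := hindep.measure_inter_preimage_eq_mul T (sets := fun _ => {(1 : ℝ)})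
    fun _ _ => measurableSet_singleton 1
  have h1 : {ω | ∀ x ∈ (T : Set X), β x ω = 1} = ⋂ x ∈ T, β x ⁻¹' {1} := by
    ext ω; simp
  have h2 : ∀ x, {ω | ∀ y ∈ ({x} : Set X), β y ω = 1} = β x ⁻¹' {1} := by
    intro x; ext ω; simp
  simp only [successProb, Measure.real, h1, h2, h, ENNReal.toReal_prod]

theorem csrPayoff_loc [IsProbabilityMeasure μ] [PartialOrder X]
    (hindep : iIndepFun β μ) (σ : ChainSearch X) (k : Fin σ.length) :
    csrPayoff μ β σ (σ.loc k) = ∏ i, if i ≤ k then successProb μ β {σ.loc i} else 1 := by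
  classical
  have h1 : σ.searchedUpTo (σ.loc k) = ((Finset.univ.filter (· ≤ k)).image σ.loc : Finset X) := by
    ext x
    simp only [ChainSearch.searchedUpTo, Set.mem_ofPred_eq, σ.strictMono.injective.eq_iff,
      exists_eq_left, Finset.coe_image, Finset.coe_filter, Finset.mem_univ, true_and,
      Set.mem_image]
  rw [csrPayoff, if_pos (Set.mem_range_self k), h1, successProb_coe_finset hindep,
    Finset.prod_image σ.strictMono.injective.injOn, Finset.prod_filter]

theorem sum_mul_csrPayoff [IsProbabilityMeasure μ] [Fintype X] [PartialOrder X]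
    (hindep : iIndepFun β μ) (q : X → ℝ) (σ : ChainSearch X) :
    ∑ h, q h * csrPayoff μ β σ h = chainScore (fun x => successProb μ β {x}) q σ.loc := by
  classical
  rw [chainScore, ← Finset.sum_subset (Finset.subset_univ (Finset.univ.image σ.loc)),
    Finset.sum_image σ.strictMono.injective.injOn]
  · exact Finset.sum_congr rfl fun k _ => by rw [csrPayoff_loc hindep]
  · intro h _ hh
    rw [csrPayoff, if_neg (by simpa using hh), mul_zero]

theorem antichainWeight_eq_sum_hiderWeight [Fintype X] [PartialOrder X] (A : Set X) :
    antichainWeight μ β A = ∑ x, hiderWeight (fun x => successProb μ β {x}) A x := by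
  rw [sum_hiderWeight]
  rfl

end Payoff

theorem mainTheorem1 {Ω X : Type*} [MeasurableSpace Ω] (μ : Measure Ω) [IsProbabilityMeasure μ]
    [Fintype X] [Nonempty X] [PartialOrder X] (β : X → Ω → ℝ)
    (hbern : ∀ x, IsBernoulliVariable μ (β x))
    (hindep : iIndepFun β μ)
    (hpos : ∀ x, 0 < successProb μ β {x}) :
    (∃ A : Set X, IsOptimalAntichain μ β A) ∧
    ∀ A : Set X, IsOptimalAntichain μ β A →
      IsGameValue (csrPayoff μ β) (1 / (oddsSum μ β (belowSet A) + (A.ncard : ℝ))) := by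

  have hp1 : ∀ x, successProb μ β {x} ≤ 1 := fun x => measureReal_le_one
  refine ⟨?_, fun A hA => ?_⟩
  · obtain ⟨A₀, -, hA₀⟩ :=
      (IsAntichain.empty : IsAntichain (· ≤ ·) (∅ : Set X)).exists_isMaximalAntichain_superset
    obtain ⟨A, hA, hmax⟩ := Set.exists_max_image {A : Set X | IsMaximalAntichain A}
      (antichainWeight μ β) (Set.toFinite _) ⟨A₀, hA₀⟩
    exact ⟨A, hA, hmax⟩
  · change IsGameValue _ (1 / antichainWeight μ β A)
    have hbound : ∀ B : Set X, IsAntichain (· ≤ ·) B →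
        ∑ x, hiderWeight (fun x => successProb μ β {x}) B x ≤ antichainWeight μ β A := by
      intro B hB
      obtain ⟨C, hBC, hC⟩ := hB.exists_isMaximalAntichain_superset
      refine (sum_hiderWeight_mono hpos hp1 hBC).trans ?_
      rw [← antichainWeight_eq_sum_hiderWeight]
      exact hA.2 C hC
    have hw0 : ∀ x, 0 ≤ hiderWeight (fun x => successProb μ β {x}) A x := by
      intro x
      have ho : 0 ≤ (1 - successProb μ β {x}) / successProb μ β {x} :=
        div_nonneg (by linarith [hp1 x]) (hpos x).le
      unfold hiderWeight
      split_ifs <;> linarith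
    have hM : 0 < antichainWeight μ β A := by
      have h1 : 0 ≤ oddsSum μ β (belowSet A) := Finset.sum_nonneg fun x _ =>
        div_nonneg (by linarith [hp1 x]) (hpos x).le
      have h2 : (0 : ℝ) < A.ncard := by exact_mod_cast hA.1.ncard_pos
      exact add_pos_of_nonneg_of_pos h1 h2
    have : Nonempty (ChainSearch X) := ⟨ChainSearch.empty X⟩
    obtain ⟨p, hp, hpv⟩ := exists_mixed_of_forall_exists_pure (csrPayoff μ β)
      (1 / antichainWeight μ β A) (by
        intro q hq
        have h := sum_le_bestScore_mul hpos hp1 q hbound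
        obtain ⟨σ, -, hσ⟩ :=
          exists_chainScore_eq_bestScore (fun x => successProb μ β {x}) q Set.univ
        refine ⟨σ, ?_⟩
        rw [sum_mul_csrPayoff hindep, hσ, div_le_iff₀ hM, ← hq.2]
        exact h)
    -- Searcher's mixture comes from minimax, Hider's is the normalized antichain weight.
    refine isGameValue_of_strategies hp
      (q := fun x => (antichainWeight μ β A)⁻¹ *
        hiderWeight (fun x => successProb μ β {x}) A x)
      ⟨fun x => mul_nonneg (inv_nonneg.mpr hM.le) (hw0 x), ?_⟩ hpv fun σ => ?_
    · rw [← Finset.mul_sum, ← antichainWeight_eq_sum_hiderWeight, inv_mul_cancel₀ hM.ne']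
    · rw [sum_mul_csrPayoff hindep, chainScore_smul, one_div]
      exact mul_le_of_le_one_right (inv_nonneg.mpr hM.le)
        (chainScore_hiderWeight_le_one hpos hp1 hA.1.1 σ.loc σ.strictMono)
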